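/- Let $(X,d)$ be a proper Hadamard space (a proper, complete geodesic metric space that is CAT(0)), with geometric boundary $\partial X$ (asymptote classes of geodesic rays), and let $\overline X=X\cup\partial X$ carry the cone topology. For $z\in X$ and $\eta\in\partial X$ let $\sigma_{z,\eta}$ be the geodesic ray from $z$ in the class $\eta$, and let $B_r(x)$ denote the open ball. A geodesic line is an isometric map $v:\mathbb R\to X$, with end points $v^\pm=v(\pm\infty)\in\partial X$; for $\xi,\eta\in\partial X$ let $(\xi\eta)\subset X$ be the set of all points $v(0)$, where $v$ is a geodesic line with $v^-=\xi$, $v^+=\eta$. For lines $u,v$ write $u\sim v$ if $u^-=v^-$, $u^+=v^+$ and $\mathcal B_{u^-}(u(0),x)=\mathcal B_{v^-}(v(0),x)$ for all $x\in X$, where $\mathcal B_\xi(p,q)=\lim_{s\to\infty}\bigl(d(p,\sigma(s))-d(q,\sigma(s))\bigr)$ for a ray $\sigma$ in the class $\xi$. The line $v$ has zero width if $\sup\{d(u(0),w(0)) : u\sim v,\ w\sim v\}=0$. It is $\mathrm{Is}(X)$-recurrent if there are isometries $g_n$ of $X$ and $t_n\to\infty$ such that the lines $t\mapsto g_n v(t+t_n)$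 converge to $v$ in the metric $d_1(u,w)=\sup_{t\in\mathbb R}e^{-|t|}d(u(t),w(t))$. Let $\partial X^{\mathrm{rec}}\subset\partial X$ be the set of the end points $v^+$ of all $\mathrm{Is}(X)$-recurrent lines $v$ of zero width. For $r>0$, $x\in X$ and $\xi\in\partial X$ put $$\mathcal O_r(\xi,x)=\{\eta\in\partial X : \text{there is a geodesic line } v \text{ with } v^-=\xi,\ v^+=\eta,\ v(0)\in B_r(x)\},$$ $$\widetilde\partial\mathcal O_r(\xi,x)=\{\eta\in\partial X : (\xi\eta)\neq\emptyset \text{ and } d(x,(\xi\eta))=r\}.$$ For $z\in X$ put $$\mathcal O^-_r(z,x)=\{\eta\in\partial X : \forall\, z'\in B_r(z),\ \sigma_{z',\eta}([0,\infty))\cap B_r(x)\neq\emptyset\},$$ $$\mathcal O^+_r(z,x)=\{\eta\in\partial X : \exists\, z'\in B_r(z),\ \sigma_{z',\eta}([0,\infty))\cap B_r(x)\neq\emptyset\},$$ and for $z\in\partial X$ put $\mathcal O^\pm_r(z,x)=\mathcal O_r(z,x)$. **Proposition.** Let $\xi\in\partial X$, $x\in X$ and $r>0$. For every sequence $(z_n)$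 in $\overline X$ converging to $\xi$, and for each of the signs $+$ and $-$: (a) $\displaystyle\limsup_{n\to\infty}\bigl(\mathcal O^\pm_r(z_n,x)\cap\partial X^{\mathrm{rec}}\bigr)\subset\bigl(\mathcal O_r(\xi,x)\cup\widetilde\partial\mathcal O_r(\xi,x)\bigr)\cap\partial X^{\mathrm{rec}}$; (b) $\displaystyle\liminf_{n\to\infty}\bigl(\mathcal O^\pm_r(z_n,x)\cap\partial X^{\mathrm{rec}}\bigr)\supset\mathcal O_r(\xi,x)\cap\partial X^{\mathrm{rec}}$. Here $\limsup_n A_n=\bigcap_n\bigcup_{k\ge n}A_k$ and $\liminf_n A_n=\bigcup_n\bigcap_{k\ge n}A_k$. -/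

import Mathlib

open Set Filter Topology
open scoped NNReal ENNReal

namespace CAT0

/-- `σ`, restricted to `[0, d(x,y)]`, is a geodesic from `x` to `y`. -/
def IsGeodesicSegment {X : Type*} [MetricSpace X] (σ : ℝ → X) (x y : X) : Prop :=
  σ 0 = x ∧ σ (dist x y) = y ∧
    ∀ s ∈ Icc (0 : ℝ) (dist x y), ∀ t ∈ Icc (0 : ℝ) (dist x y), dist (σ s) (σ t) = |s - t|

/-- A Hadamard space: a complete geodesic metric space all of whose geodesic triangles satisfy the
CAT(0) inequality. In the inequality `p, q, r` are the vertices of the triangle, `σ` and `τ` are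
two of its sides (any two sides share a vertex, here called `p`), `p', q', r'` is a comparison
triangle in the Euclidean plane, and `a', b'` are the comparison points of `σ s` and `τ t`. -/
class HadamardSpace (X : Type*) [MetricSpace X] : Prop where
  complete : CompleteSpace X
  exists_geodesic : ∀ x y : X, ∃ σ : ℝ → X, IsGeodesicSegment σ x y
  cat_zero : ∀ (p q r : X) (σ τ : ℝ → X),
    IsGeodesicSegment σ p q → IsGeodesicSegment τ p r →
    ∀ p' q' r' : EuclideanSpace ℝ (Fin 2),
      dist p' q' = dist p q → dist p' r' = dist p r → dist q' r' = dist q r →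
    ∀ s ∈ Icc (0 : ℝ) (dist p q), ∀ t ∈ Icc (0 : ℝ) (dist p r),
    ∀ a' ∈ segment ℝ p' q', ∀ b' ∈ segment ℝ p' r', dist p' a' = s → dist p' b' = t →
      dist (σ s) (τ t) ≤ dist a' b'

/-- A geodesic ray: an isometric map `[0,∞) → X`. -/
structure GeodesicRay (X : Type*) [MetricSpace X] where
  toFun : ℝ≥0 → X
  isometry : Isometry toFun

instance (X : Type*) [MetricSpace X] : CoeFun (GeodesicRay X) (fun _ => ℝ≥0 → X) :=
  ⟨GeodesicRay.toFun⟩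

/-- Two rays are asymptotic if they stay at bounded distance from each other. -/
instance asymptotic (X : Type*) [MetricSpace X] : Setoid (GeodesicRay X) where
  r σ τ := ∃ C : ℝ, ∀ t : ℝ≥0, dist (σ t) (τ t) ≤ C
  iseqv :=
    { refl := fun σ => ⟨0, fun t => by simp⟩
      symm := fun ⟨C, h⟩ => ⟨C, fun t => by rw [dist_comm]; exact h t⟩
      trans := fun ⟨C, h⟩ ⟨D, k⟩ =>
        ⟨C + D, fun t => (dist_triangle _ _ _).trans (add_le_add (h t) (k t))⟩ }

/-- The geometric boundary `∂X`: asymptote classes of geodesic rays. -/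
def Boundary (X : Type*) [MetricSpace X] : Type _ := Quotient (asymptotic X)

/-- The boundary point represented by a ray. -/
def GeodesicRay.endpoint {X : Type*} [MetricSpace X] (σ : GeodesicRay X) : Boundary X :=
  Quotient.mk (asymptotic X) σ

/-- The set `X ∪ ∂X`. -/
inductive Compactification (X : Type*) [MetricSpace X] where
  | pt : X → Compactification X
  | bd : Boundary X → Compactification X

/-- `σ` is the geodesic `σ_{p,z}` from `p ∈ X` to `z ∈ X ∪ ∂X`; if `z` lies in `X`, it is continued
by the constant `z` after its arrival. -/
def IsGeodesicTo {X : Type*} [MetricSpace X] (σ : ℝ≥0 → X) (p : X) : Compactification X → Prop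
  | .pt y => σ 0 = p ∧
      (∀ s t : ℝ≥0, (s : ℝ) ≤ dist p y → (t : ℝ) ≤ dist p y → dist (σ s) (σ t) = dist s t) ∧
      ∀ t : ℝ≥0, dist p y ≤ (t : ℝ) → σ t = y
  | .bd ξ => ∃ τ : GeodesicRay X, τ.toFun = σ ∧ σ 0 = p ∧ τ.endpoint = ξ

/-- The cone topology on `X ∪ ∂X`: the coarsest topology for which all the maps `z ↦ σ_{p,z}(t)`
with `p ∈ X` and `t ≥ 0` are continuous (in a Hadamard space `σ_{p,z}` exists and is unique). -/
instance (X : Type*) [MetricSpace X] : TopologicalSpace (Compactification X) :=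
  TopologicalSpace.generateFrom
    {S | ∃ (p : X) (t : ℝ≥0) (U : Set X), IsOpen U ∧
      S = {z | ∃ σ : ℝ≥0 → X, IsGeodesicTo σ p z ∧ σ t ∈ U}}

/-- A parametrized geodesic line: an isometric map `ℝ → X`. -/
structure GeodesicLine (X : Type*) [MetricSpace X] where
  toFun : ℝ → X
  isometry : Isometry toFun

instance (X : Type*) [MetricSpace X] : CoeFun (GeodesicLine X) (fun _ => ℝ → X) :=
  ⟨GeodesicLine.toFun⟩

namespace GeodesicLine

variable {X : Type*} [MetricSpace X]

/-- The positive half of a line. -/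
def posRay (v : GeodesicLine X) : GeodesicRay X where
  toFun t := v (t : ℝ)
  isometry := Isometry.of_dist_eq fun s t => by rw [v.isometry.dist_eq, NNReal.dist_eq, Real.dist_eq]

/-- The negative half of a line. -/
def negRay (v : GeodesicLine X) : GeodesicRay X where
  toFun t := v (-(t : ℝ))
  isometry := Isometry.of_dist_eq fun s t => by
    rw [v.isometry.dist_eq, dist_neg_neg, NNReal.dist_eq, Real.dist_eq]

/-- The end point `v⁺`. -/
def pos (v : GeodesicLine X) : Boundary X := v.posRay.endpoint

/-- The end point `v⁻`. -/
def neg (v : GeodesicLine X) : Boundary X := v.negRay.endpoint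

/-- The geodesic flow `(g^s v)(t) = v(t + s)`. -/
def flow (s : ℝ) (v : GeodesicLine X) : GeodesicLine X where
  toFun t := v (t + s)
  isometry := Isometry.of_dist_eq fun a b => by rw [v.isometry.dist_eq, dist_add_right]

/-- The action of an isometry of `X` on lines. -/
def translate (g : X ≃ᵢ X) (v : GeodesicLine X) : GeodesicLine X where
  toFun t := g (v t)
  isometry := g.isometry.comp v.isometry

/-- The metric `d₁(u,v) = sup_t e^{-|t|} d(u(t),v(t))` on the set of lines. -/
noncomputable def d₁ (u v : GeodesicLine X) : ℝ :=
  ⨆ t : ℝ, Real.exp (-|t|) * dist (v t) (u t)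

/-- The supremum defining `d₁` is that of a bounded set. -/
theorem bddAbove_d₁ (u v : GeodesicLine X) :
    BddAbove (range fun t : ℝ => Real.exp (-|t|) * dist (v t) (u t)) := by
  refine ⟨dist (v 0) (u 0) + 2, ?_⟩
  rintro _ ⟨t, rfl⟩
  have h1 : dist (v t) (u t) ≤ |t| + dist (v 0) (u 0) + |t| := by
    have := dist_triangle4 (v t) (v 0) (u 0) (u t)
    rw [v.isometry.dist_eq, u.isometry.dist_eq, Real.dist_eq, Real.dist_eq] at this
    simpa using this
  have h2 : Real.exp (-|t|) ≤ 1 := Real.exp_le_one_iff.2 (by simp)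
  have h3 : Real.exp (-|t|) * |t| ≤ 1 := by
    have h4 : |t| ≤ Real.exp |t| := by linarith [Real.add_one_le_exp |t|]
    calc Real.exp (-|t|) * |t| ≤ Real.exp (-|t|) * Real.exp |t| := by gcongr
      _ = 1 := by rw [← Real.exp_add]; simp
  have h5 : 0 ≤ dist (v 0) (u 0) := dist_nonneg
  have h6 : 0 < Real.exp (-|t|) := Real.exp_pos _
  show Real.exp (-|t|) * dist (v t) (u t) ≤ _
  nlinarith [mul_le_mul_of_nonneg_left h1 h6.le, mul_le_mul_of_nonneg_right h2 h5]

end GeodesicLine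

/-- The Busemann function `B_ξ(x,y) = lim_{s → ∞} (d(x,σ(s)) - d(y,σ(s)))`, for a ray `σ` in the
class `ξ` (the limit does not depend on the ray when `X` is a Hadamard space). -/
noncomputable def busemann {X : Type*} [MetricSpace X] (ξ : Boundary X) (x y : X) : ℝ :=
  limUnder atTop fun s : ℝ≥0 =>
    dist x ((Quotient.out ξ : GeodesicRay X) s) - dist y ((Quotient.out ξ : GeodesicRay X) s)

/-- The limit defining the Busemann function exists. -/
theorem tendsto_busemann {X : Type*} [MetricSpace X] (ξ : Boundary X) (x y : X) :
    Tendsto (fun s : ℝ≥0 =>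
      dist x ((Quotient.out ξ : GeodesicRay X) s) - dist y ((Quotient.out ξ : GeodesicRay X) s))
      atTop (𝓝 (busemann ξ x y)) := by
  refine tendsto_nhds_limUnder ?_
  set σ : GeodesicRay X := Quotient.out ξ
  have key : ∀ w : X, ∃ l, Tendsto (fun s : ℝ≥0 => dist w (σ s) - s) atTop (𝓝 l) := by
    intro w
    refine ⟨_, tendsto_atTop_ciInf (f := fun s : ℝ≥0 => dist w (σ s) - (s : ℝ)) ?_ ?_⟩
    · intro s t hst
      have h1 := dist_triangle w (σ s) (σ t)
      rw [σ.isometry.dist_eq, NNReal.dist_eq, abs_sub_comm,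
        abs_of_nonneg (sub_nonneg.2 (NNReal.coe_le_coe.2 hst))] at h1
      show dist w (σ t) - (t : ℝ) ≤ dist w (σ s) - (s : ℝ)
      linarith
    · refine ⟨-dist w (σ 0), ?_⟩
      rintro _ ⟨s, rfl⟩
      have h1 := dist_triangle_left (σ 0) (σ s) w
      rw [σ.isometry.dist_eq, NNReal.dist_eq] at h1
      have h2 : ((s : ℝ≥0) : ℝ) ≤ |((0 : ℝ≥0) : ℝ) - (s : ℝ)| := by
        rw [abs_sub_comm]; simp
      show -dist w (σ 0) ≤ dist w (σ s) - (s : ℝ)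
      linarith
  obtain ⟨a, ha⟩ := key x
  obtain ⟨b, hb⟩ := key y
  exact ⟨a - b, (ha.sub hb).congr fun s => by ring⟩

namespace GeodesicLine

variable {X : Type*} [MetricSpace X]

/-- The Hopf parametrization `H_x(v) = (v⁻, v⁺, B_{v⁻}(v(0), x))`. -/
noncomputable def hopf (x : X) (v : GeodesicLine X) : Boundary X × Boundary X × ℝ :=
  (v.neg, v.pos, busemann v.neg (v 0) x)

/-- The relation `u ∼ v` : equal Hopf parameters (with respect to any base point). -/
def HopfEquiv (u v : GeodesicLine X) : Prop := ∀ x : X, hopf x u = hopf x v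

/-- The width of `v`: the supremum of `d(u(0),w(0))` over `u, w ∼ v`; it may be infinite. -/
noncomputable def width (v : GeodesicLine X) : ℝ≥0∞ :=
  ⨆ (u : GeodesicLine X) (_ : HopfEquiv u v) (w : GeodesicLine X) (_ : HopfEquiv w v),
    edist (u 0) (w 0)

/-- `v` is rank one: its width is finite. -/
def IsRankOne (v : GeodesicLine X) : Prop := v.width < ⊤

/-- `v` is rank one of zero width. -/
def IsZeroWidth (v : GeodesicLine X) : Prop := v.IsRankOne ∧ v.width = 0

/-- `v` `G`-accumulates on `u`: there are `g_n ∈ G` and `t_n → ∞` with `g_n g^{t_n} v → u`. -/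
def AccumulatesOn (G : Subgroup (X ≃ᵢ X)) (v u : GeodesicLine X) : Prop :=
  ∃ (g : ℕ → X ≃ᵢ X) (t : ℕ → ℝ), (∀ n, g n ∈ G) ∧ Tendsto t atTop atTop ∧
    Tendsto (fun n => d₁ (translate (g n) (flow (t n) v)) u) atTop (𝓝 0)

/-- `v` is `G`-recurrent. -/
def IsRecurrent (G : Subgroup (X ≃ᵢ X)) (v : GeodesicLine X) : Prop := AccumulatesOn G v v

end GeodesicLine

/-- `∂X^rec`: the points `v⁺` for `v` a zero width line which is recurrent for the full isometry
group of `X`. -/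
def recBoundary (X : Type*) [MetricSpace X] : Set (Boundary X) :=
  {η | ∃ v : GeodesicLine X, v.IsZeroWidth ∧ v.IsRecurrent ⊤ ∧ η = v.pos}

/-- `(ξη)`: the points of `X` which lie on a line from `ξ` to `η`. -/
def joinSet {X : Type*} [MetricSpace X] (ξ η : Boundary X) : Set X :=
  {p | ∃ v : GeodesicLine X, v.neg = ξ ∧ v.pos = η ∧ v 0 = p}

/-- The shadow `O_r(ξ,y)` with source `ξ ∈ ∂X`. -/
def shadow {X : Type*} [MetricSpace X] (r : ℝ) (ξ : Boundary X) (y : X) : Set (Boundary X) :=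
  {η | ∃ v : GeodesicLine X, v.neg = ξ ∧ v.pos = η ∧ v 0 ∈ Metric.ball y r}

/-- The set `∂̃O_r(ξ,y)` of those `η` that can be joined to `ξ` and satisfy `d(y,(ξη)) = r`. -/
def shadowFrontier {X : Type*} [MetricSpace X] (r : ℝ) (ξ : Boundary X) (y : X) :
    Set (Boundary X) :=
  {η | (∃ v : GeodesicLine X, v.neg = ξ ∧ v.pos = η) ∧ Metric.infDist y (joinSet ξ η) = r}

/-- The ray `σ_{z,η}` from `z ∈ X` to `η ∈ ∂X` (which exists and is unique in a Hadamard space)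
meets the open ball `B_r(y)`. -/
def RayMeetsBall {X : Type*} [MetricSpace X] (r : ℝ) (z : X) (η : Boundary X) (y : X) : Prop :=
  ∃ σ : GeodesicRay X, σ 0 = z ∧ σ.endpoint = η ∧ ∃ t : ℝ≥0, σ t ∈ Metric.ball y r

/-- The small shadow `O⁻_r(z,y)` with source `z ∈ X ∪ ∂X`. -/
def smallShadow {X : Type*} [MetricSpace X] (r : ℝ) (z : Compactification X) (y : X) :
    Set (Boundary X) :=
  match z with
  | .pt x => {η | ∀ x' ∈ Metric.ball x r, RayMeetsBall r x' η y}
  | .bd ξ => shadow r ξ y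

/-- The large shadow `O⁺_r(z,y)` with source `z ∈ X ∪ ∂X`. -/
def largeShadow {X : Type*} [MetricSpace X] (r : ℝ) (z : Compactification X) (y : X) :
    Set (Boundary X) :=
  match z with
  | .pt x => {η | ∃ x' ∈ Metric.ball x r, RayMeetsBall r x' η y}
  | .bd ξ => shadow r ξ y

end CAT0

open CAT0

/-! The upper inclusion (a) is compactness. If `η` lies in infinitely many large shadows, there are
rays to `η` that start at points tending to `ξ` and pass within `r` of `x`. Parametrized from their
passage near `x`, they fellow travel a fixed ray to `η` in one direction and a fixed ray to `ξ` in
the other, so they have a limit line from `ξ` to `η` at distance at most `r` from `x`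
(`exists_line_limit_of_rays`). Distance `< r` to `(ξη)` gives the shadow, distance `= r` its
frontier.

The lower inclusion (b) needs rigidity. Let the line `u` end at the same point as a recurrent zero
width line `v`. Moved by the recurrence isometries, `u` accumulates on a line parallel to `v`, that
is, on a reparametrization of `v`; as the distance between `u` and a shift of `v` decreases along
the lines, it must tend to `0`. Hence two lines with the same end points, the positive one in
`∂X^rec`, coincide up to parametrization: their distance, suitably shifted, tends to `0` forwards
but cannot decrease (`exists_shift_of_mem_recBoundary`).

Rigidity makes rays to `u⁺` from points near `u⁻` pass close to `u(0)` (`exists_forall_ray_near`).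
Otherwise, by the intermediate value theorem, one finds starting points tending to `u⁻` whose rays
have distance exactly `ε` from `u(0)`. These accumulate on a line from `u⁻` to `u⁺`, which passes
through `u(0)` by rigidity, a contradiction. For `z_n` in `X` this is (b) directly; for `z_n` in
`∂X`, rays from points going to `z_n` converge to a line from `z_n` that passes near `u(0)`. -/

namespace CAT0

/-! ### Comparison geometry: convexity of the metric and fellow travelling -/

/-- The restriction of `c` to `S` preserves distances. -/
def IsometricOn {X : Type*} [MetricSpace X] (c : ℝ → X) (S : Set ℝ) : Prop :=
  ∀ s ∈ S, ∀ t ∈ S, dist (c s) (c t) = |s - t|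

theorem IsometricOn.mono {X : Type*} [MetricSpace X] {c : ℝ → X} {S T : Set ℝ}
    (h : IsometricOn c T) (hST : S ⊆ T) : IsometricOn c S :=
  fun s hs t ht => h s (hST hs) t (hST ht)

/-- Reversing a geodesic. -/
theorem IsometricOn.reverse {X : Type*} [MetricSpace X] {c : ℝ → X} {a b : ℝ}
    (h : IsometricOn c (Icc (b - a) b)) : IsometricOn (fun t => c (b - t)) (Icc 0 a) := by
  intro s hs t ht
  rw [h (b - s) ⟨by linarith [hs.2], by linarith [hs.1]⟩ (b - t)
    ⟨by linarith [ht.2], by linarith [ht.1]⟩, abs_sub_comm]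
  congr 1; ring

theorem IsometricOn.shift {X : Type*} [MetricSpace X] {c : ℝ → X} {S : Set ℝ} (b : ℝ) {T : Set ℝ}
    (h : IsometricOn c S) (hT : ∀ t ∈ T, b + t ∈ S) : IsometricOn (fun t => c (b + t)) T := by
  intro s hs t ht
  rw [h _ (hT s hs) _ (hT t ht)]
  congr 1; ring

/-- Comparison triangles exist. -/
theorem exists_comparison_triangle {a b d : ℝ} (ha : 0 ≤ a) (hb : 0 ≤ b)
    (h1 : d ≤ a + b) (h2 : a ≤ b + d) (h3 : b ≤ a + d) :
    ∃ q r : EuclideanSpace ℝ (Fin 2), ‖q‖ = a ∧ ‖r‖ = b ∧ dist q r = d := by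
  rcases ha.eq_or_lt with rfl | ha
  · obtain rfl : d = b := by linarith
    exact ⟨0, !₂[d, 0], by simp, by simp [EuclideanSpace.norm_eq, Real.sqrt_sq_eq_abs, abs_of_nonneg hb],
      by simp [dist_eq_norm, EuclideanSpace.norm_eq, Real.sqrt_sq_eq_abs, abs_of_nonneg hb]⟩
  · have hd : 0 ≤ d := by linarith
    -- Law of cosines: with the first vertex at the origin and `q` on the first axis, `x` is the
    -- first coordinate of `r`. Dividing by `a` is why `a = 0` was split off.
    set x := (a ^ 2 + b ^ 2 - d ^ 2) / (2 * a) with hx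
    have hxa : 2 * a * x = a ^ 2 + b ^ 2 - d ^ 2 := by rw [hx]; field_simp
    have hx1 : x ≤ b := by
      rw [hx, div_le_iff₀ (by positivity)]
      nlinarith [mul_nonneg (by linarith : 0 ≤ d - (a - b)) (by linarith : 0 ≤ d + (a - b))]
    have hx2 : -b ≤ x := by
      rw [hx, le_div_iff₀ (by positivity)]
      nlinarith [mul_nonneg (by linarith : 0 ≤ a + b - d) (by linarith : 0 ≤ a + b + d)]
    have hy : 0 ≤ b ^ 2 - x ^ 2 := by nlinarith
    refine ⟨!₂[a, 0], !₂[x, √(b ^ 2 - x ^ 2)], ?_, ?_, ?_⟩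
    · simp [EuclideanSpace.norm_eq, Real.sqrt_sq_eq_abs, abs_of_pos ha]
    · simp [EuclideanSpace.norm_eq, Real.sq_sqrt hy, Real.sqrt_sq_eq_abs, abs_of_nonneg hb]
    · rw [dist_eq_norm, EuclideanSpace.norm_eq, ← Real.sqrt_sq hd]
      congr 1
      simp [Real.sq_sqrt hy]
      nlinarith

variable {X : Type*} [MetricSpace X] [HadamardSpace X]

theorem exists_isometricOn (p q : X) :
    ∃ c : ℝ → X, c 0 = p ∧ c (dist p q) = q ∧ IsometricOn c (Icc 0 (dist p q)) :=
  HadamardSpace.exists_geodesic p q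

/-- Two geodesics with a common starting point diverge at least linearly. -/
theorem dist_le_mul_of_common_start {c c' : ℝ → X} {a b l : ℝ} (ha : 0 ≤ a) (hb : 0 ≤ b)
    (hc : IsometricOn c (Icc 0 a)) (hc' : IsometricOn c' (Icc 0 b)) (h0 : c 0 = c' 0)
    (hl : l ∈ Icc (0 : ℝ) 1) : dist (c (l * a)) (c' (l * b)) ≤ l * dist (c a) (c' b) := by
  have h1 : dist (c 0) (c a) = a := by
    rw [hc 0 ⟨le_rfl, ha⟩ a ⟨ha, le_rfl⟩, zero_sub, abs_neg, abs_of_nonneg ha]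
  have h2 : dist (c 0) (c' b) = b := by
    rw [h0, hc' 0 ⟨le_rfl, hb⟩ b ⟨hb, le_rfl⟩, zero_sub, abs_neg, abs_of_nonneg hb]
  obtain ⟨q, r, hq, hr, hqr⟩ := exists_comparison_triangle ha hb (d := dist (c a) (c' b))
    (by have := dist_triangle_left (c a) (c' b) (c 0); linarith)
    (by have := dist_triangle_right (c 0) (c a) (c' b); linarith)
    (by have := dist_triangle (c 0) (c a) (c' b); linarith)
  have key := HadamardSpace.cat_zero (c 0) (c a) (c' b) c c'
    ⟨rfl, by rw [h1], by rw [h1]; exact hc⟩ ⟨h0.symm, by rw [h2], by rw [h2]; exact hc'⟩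
    0 q r (by rw [dist_zero_left, hq, h1]) (by rw [dist_zero_left, hr, h2]) hqr
    (l * a) ⟨by have := hl.1; positivity, by rw [h1]; nlinarith [hl.2]⟩
    (l * b) ⟨by have := hl.1; positivity, by rw [h2]; nlinarith [hl.2]⟩
    (l • q) (by rw [segment_eq_image]; exact ⟨l, hl, by simp⟩)
    (l • r) (by rw [segment_eq_image]; exact ⟨l, hl, by simp⟩)
    (by rw [dist_zero_left, norm_smul, hq, Real.norm_of_nonneg hl.1])
    (by rw [dist_zero_left, norm_smul, hr, Real.norm_of_nonneg hl.1])
  rwa [dist_smul₀, hqr, Real.norm_of_nonneg hl.1] at key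

/-- Convexity of the metric. -/
theorem dist_le_convex {c c' : ℝ → X} {a b l : ℝ} (ha : 0 ≤ a) (hb : 0 ≤ b)
    (hc : IsometricOn c (Icc 0 a)) (hc' : IsometricOn c' (Icc 0 b))
    (hl : l ∈ Icc (0 : ℝ) 1) :
    dist (c (l * a)) (c' (l * b)) ≤ (1 - l) * dist (c 0) (c' 0) + l * dist (c a) (c' b) := by
  -- The diagonal `e` cuts the quadrilateral into two triangles. The second one has its common
  -- vertex at `c' b`, so its sides are reversed and `l` becomes `1 - l`.
  obtain ⟨e, he0, he1, he⟩ := exists_isometricOn (c 0) (c' b)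
  set m := dist (c 0) (c' b) with hm
  have hm0 : 0 ≤ m := dist_nonneg
  have k1 := dist_le_mul_of_common_start ha hm0 hc he he0.symm hl
  have k2 := dist_le_mul_of_common_start (l := 1 - l) hm0 hb
    (IsometricOn.reverse (a := m) (b := m) (by simpa using he))
    (IsometricOn.reverse (a := b) (b := b) (by simpa using hc')) (by simp [he1])
    ⟨by linarith [hl.2], by linarith [hl.1]⟩
  simp only [sub_self, he0] at k2
  rw [show m - (1 - l) * m = l * m by ring, show b - (1 - l) * b = l * b by ring] at k2
  rw [he1] at k1
  linarith [dist_triangle (c (l * a)) (e (l * m)) (c' (l * b))]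

/-- Geodesics with nearby end points fellow travel. -/
theorem dist_le_fellow_travel {c c' : ℝ → X} {a b t D E : ℝ} (ha : 0 < a) (hb : 0 ≤ b)
    (hc : IsometricOn c (Icc 0 a)) (hc' : IsometricOn c' (Icc 0 b)) (ht : 0 ≤ t) (hta : t ≤ a)
    (htb : t ≤ b) (hD : dist (c 0) (c' 0) ≤ D) (hE : dist (c a) (c' b) ≤ E) :
    dist (c t) (c' t) ≤ D + t / a * (D + 2 * E) := by
  have hl : t / a ∈ Icc (0 : ℝ) 1 := ⟨by positivity, by rw [div_le_one ha]; exact hta⟩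
  have k := dist_le_convex ha.le hb hc hc' hl
  rw [div_mul_cancel₀ _ ha.ne'] at k
  -- Convexity compares `c t` with the proportional point on `c'`; passing from there to `c' t`
  -- costs a fraction `t / a` of the difference of the lengths.
  have k2 : dist (c' (t / a * b)) (c' t) = t / a * |b - a| := by
    rw [hc' _ ⟨mul_nonneg hl.1 hb, by nlinarith [hl.2]⟩ _ ⟨ht, htb⟩, ← abs_of_nonneg hl.1,
      ← abs_mul, abs_of_nonneg hl.1]
    congr 1; field_simp
  have k3 : |b - a| ≤ D + E := by
    have h1 : dist (c 0) (c a) = a := by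
      rw [hc 0 ⟨le_rfl, ha.le⟩ a ⟨ha.le, le_rfl⟩, zero_sub, abs_neg, abs_of_nonneg ha.le]
    have h2 : dist (c' 0) (c' b) = b := by
      rw [hc' 0 ⟨le_rfl, hb⟩ b ⟨hb, le_rfl⟩, zero_sub, abs_neg, abs_of_nonneg hb]
    have h3 := dist_triangle4 (c 0) (c' 0) (c' b) (c a)
    have h4 := dist_triangle4 (c' 0) (c 0) (c a) (c' b)
    rw [dist_comm (c' b)] at h3
    rw [dist_comm (c' 0) (c 0)] at h4
    rw [abs_le]; constructor <;> linarith
  have k4 := dist_triangle (c t) (c' (t / a * b)) (c' t)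
  have hD0 : 0 ≤ D := dist_nonneg.trans hD
  nlinarith [mul_le_mul_of_nonneg_left k3 hl.1, mul_le_mul_of_nonneg_left hE hl.1,
    mul_le_mul_of_nonneg_left hD (sub_nonneg.2 hl.2), mul_nonneg hl.1 hD0]

/-- Fellow travelling, uniform version. -/
theorem dist_le_fellow_travel' {c c' : ℝ → X} {a b t D E : ℝ} (ha : 0 ≤ a) (hb : 0 ≤ b)
    (hc : IsometricOn c (Icc 0 a)) (hc' : IsometricOn c' (Icc 0 b)) (ht : 0 ≤ t) (hta : t ≤ a)
    (htb : t ≤ b) (hD : dist (c 0) (c' 0) ≤ D) (hE : dist (c a) (c' b) ≤ E) :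
    dist (c t) (c' t) ≤ 2 * D + 2 * E := by
  have hD0 : 0 ≤ D := dist_nonneg.trans hD
  have hE0 : 0 ≤ E := dist_nonneg.trans hE
  rcases ha.eq_or_lt with rfl | ha
  · obtain rfl : t = 0 := le_antisymm hta ht
    linarith
  · have h := dist_le_fellow_travel ha hb hc hc' ht hta htb hD hE
    have h1 : t / a ≤ 1 := by rw [div_le_one ha]; exact hta
    nlinarith [mul_le_mul_of_nonneg_right h1 (by linarith : 0 ≤ D + 2 * E)]

/-- The distance between asymptotic geodesic rays does not increase. -/
theorem dist_le_of_bounded {c c' : ℝ → X} (hc : IsometricOn c (Ici 0))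
    (hc' : IsometricOn c' (Ici 0)) {C : ℝ} (hC : ∀ t, 0 ≤ t → dist (c t) (c' t) ≤ C)
    {t : ℝ} (ht : 0 ≤ t) : dist (c t) (c' t) ≤ dist (c 0) (c' 0) := by
  -- Convexity on `[0, T]` bounds the distance at `t` by this interpolation; the weight of the bound
  -- `C` vanishes as `T → ∞`.
  have hlim : Tendsto (fun T : ℝ => (1 - t / T) * dist (c 0) (c' 0) + t / T * C) atTop
      (𝓝 ((1 - 0) * dist (c 0) (c' 0) + 0 * C)) := by
    have h : Tendsto (fun T : ℝ => t / T) atTop (𝓝 0) := tendsto_const_nhds.div_atTop tendsto_id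
    exact ((tendsto_const_nhds.sub h).mul tendsto_const_nhds).add (h.mul tendsto_const_nhds)
  have h := ge_of_tendsto (b := dist (c t) (c' t)) hlim ?_
  · simpa using h
  filter_upwards [eventually_ge_atTop t, eventually_gt_atTop 0] with T hT hT0
  have hl : t / T ∈ Icc (0 : ℝ) 1 := ⟨by positivity, by rw [div_le_one hT0]; exact hT⟩
  have k := dist_le_convex hT0.le hT0.le (hc.mono fun s hs => hs.1) (hc'.mono fun s hs => hs.1) hl
  rw [div_mul_cancel₀ _ hT0.ne'] at k
  exact k.trans (by gcongr; exact hC T hT0.le)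

end CAT0

namespace CAT0

/-! ### Curves ending at boundary points, and limits along ultrafilters -/

section Metric

variable {X : Type*} [MetricSpace X]

/-- The curve `c` stays, for `t ≥ 0`, at bounded distance from the rays of the class `η`. -/
def EndsAt (c : ℝ → X) (η : Boundary X) : Prop :=
  ∃ C : ℝ, ∀ t : ℝ≥0, dist (c t) ((Quotient.out η : GeodesicRay X) t) ≤ C

theorem EndsAt.of_bounded {c c' : ℝ → X} {η : Boundary X} (h : EndsAt c η) {D : ℝ}
    (hD : ∀ t, 0 ≤ t → dist (c' t) (c t) ≤ D) : EndsAt c' η := by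
  obtain ⟨C, hC⟩ := h
  exact ⟨D + C, fun t => (dist_triangle _ _ _).trans (add_le_add (hD t t.2) (hC t))⟩

theorem EndsAt.bounded {c c' : ℝ → X} {η : Boundary X} (h : EndsAt c η) (h' : EndsAt c' η) :
    ∃ C : ℝ, ∀ t, 0 ≤ t → dist (c t) (c' t) ≤ C := by
  obtain ⟨C, hC⟩ := h
  obtain ⟨D, hD⟩ := h'
  exact ⟨C + D, fun t ht => (dist_triangle_right _ _ _).trans
    (add_le_add (hC ⟨t, ht⟩) (hD ⟨t, ht⟩))⟩

theorem EndsAt.comp_add {c : ℝ → X} {η : Boundary X} (h : EndsAt c η)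
    (hc : IsometricOn c (Ici 0)) {b : ℝ} (hb : 0 ≤ b) : EndsAt (fun t => c (b + t)) η :=
  h.of_bounded (D := b) fun t ht => by
    rw [hc _ (add_nonneg hb ht) _ ht, add_sub_cancel_right, abs_of_nonneg hb]

/-- A ray as a curve defined on all of `ℝ`. -/
def GeodesicRay.extend (σ : GeodesicRay X) (t : ℝ) : X := σ t.toNNReal

theorem GeodesicRay.isometricOn (σ : GeodesicRay X) : IsometricOn σ.extend (Ici 0) := by
  intro s hs t ht
  rw [GeodesicRay.extend, GeodesicRay.extend, σ.isometry.dist_eq, NNReal.dist_eq,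
    Real.coe_toNNReal _ hs, Real.coe_toNNReal _ ht]

/-- The ray given by a curve that is isometric on `[0,∞)`. -/
def GeodesicRay.ofCurve (c : ℝ → X) (hc : IsometricOn c (Ici 0)) : GeodesicRay X where
  toFun t := c t
  isometry := Isometry.of_dist_eq fun s t => hc _ s.2 _ t.2

theorem GeodesicRay.endpoint_eq_iff {σ : GeodesicRay X} {η : Boundary X} :
    σ.endpoint = η ↔ ∃ C : ℝ, ∀ t : ℝ≥0, dist (σ t) ((Quotient.out η : GeodesicRay X) t) ≤ C :=
  Quotient.mk_eq_iff_out

theorem GeodesicRay.endsAt_extend {σ : GeodesicRay X} {η : Boundary X} :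
    EndsAt σ.extend η ↔ σ.endpoint = η := by
  rw [GeodesicRay.endpoint_eq_iff]
  simp [EndsAt, GeodesicRay.extend]

theorem GeodesicRay.endpoint_ofCurve {c : ℝ → X} {hc : IsometricOn c (Ici 0)} {η : Boundary X} :
    (GeodesicRay.ofCurve c hc).endpoint = η ↔ EndsAt c η :=
  GeodesicRay.endpoint_eq_iff

namespace GeodesicLine

theorem isometricOn (v : GeodesicLine X) (S : Set ℝ) : IsometricOn v S := fun s _ t _ => by
  rw [v.isometry.dist_eq, Real.dist_eq]

theorem isometricOn_neg (v : GeodesicLine X) (S : Set ℝ) : IsometricOn (fun t => v (-t)) S :=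
  fun s _ t _ => by rw [v.isometry.dist_eq, dist_neg_neg, Real.dist_eq]

theorem endsAt_pos {v : GeodesicLine X} {η : Boundary X} : EndsAt v η ↔ v.pos = η :=
  (GeodesicRay.endpoint_eq_iff (σ := v.posRay)).symm

theorem endsAt_neg {v : GeodesicLine X} {η : Boundary X} :
    EndsAt (fun t => v (-t)) η ↔ v.neg = η :=
  (GeodesicRay.endpoint_eq_iff (σ := v.negRay)).symm

theorem flow_pos (s : ℝ) (v : GeodesicLine X) : (flow s v).pos = v.pos := by
  rw [← endsAt_pos]
  refine (endsAt_pos.2 rfl : EndsAt v v.pos).of_bounded (D := |s|) fun t _ => ?_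
  show dist (v (t + s)) (v t) ≤ _
  rw [v.isometry.dist_eq, Real.dist_eq, add_sub_cancel_left]

theorem flow_neg (s : ℝ) (v : GeodesicLine X) : (flow s v).neg = v.neg := by
  rw [← endsAt_neg]
  refine (endsAt_neg.2 rfl : EndsAt (fun t => v (-t)) v.neg).of_bounded (D := |s|) fun t _ => ?_
  show dist (v (-t + s)) (v (-t)) ≤ _
  rw [v.isometry.dist_eq, Real.dist_eq, add_sub_cancel_left]

end GeodesicLine

theorem rayMeetsBall_iff {r : ℝ} {z y : X} {η : Boundary X} :
    RayMeetsBall r z η y ↔ ∃ c : ℝ → X, IsometricOn c (Ici 0) ∧ c 0 = z ∧ EndsAt c η ∧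
      ∃ t, 0 ≤ t ∧ dist (c t) y < r := by
  constructor
  · rintro ⟨σ, h0, h1, t, ht⟩
    exact ⟨σ.extend, σ.isometricOn, by simpa [GeodesicRay.extend] using h0,
      GeodesicRay.endsAt_extend.2 h1, t, t.2, by simpa [GeodesicRay.extend] using ht⟩
  · rintro ⟨c, hc, h0, h1, t, ht, h⟩
    exact ⟨GeodesicRay.ofCurve c hc, h0, GeodesicRay.endpoint_ofCurve.2 h1, ⟨t, ht⟩, h⟩

/-- In a proper space, bounded families of points have limits along ultrafilters. -/
theorem exists_ultrafilter_limit [ProperSpace X] {ι α : Type*} (U : Ultrafilter ι)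
    (f : ι → α → X) (p : α → X) (R : α → ℝ)
    (h : ∀ a, ∀ᶠ n in (U : Filter ι), dist (f n a) (p a) ≤ R a) :
    ∃ w : α → X, ∀ a, Tendsto (fun n => f n a) U (𝓝 (w a)) := by
  have key : ∀ a, ∃ x, Tendsto (fun n => f n a) U (𝓝 x) := by
    intro a
    obtain ⟨x, -, hx⟩ := (isCompact_closedBall (p a) (R a)).ultrafilter_le_nhds
      (U.map fun n => f n a) (by
        rw [le_principal_iff]
        exact h a)
    exact ⟨x, hx⟩
  choose w hw using key
  exact ⟨w, hw⟩

/-- Limits along an ultrafilter of geodesics of growing length are lines. -/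
theorem exists_line_limit [ProperSpace X] {ι : Type*} (U : Ultrafilter ι) {f : ι → ℝ → X}
    {ξ η : Boundary X} {C : ℝ} {ζ ρ : ℝ → X} (hζ : EndsAt ζ ξ) (hρ : EndsAt ρ η)
    (h1 : ∀ T, ∀ᶠ n in (U : Filter ι), IsometricOn (f n) (Ici (-T)))
    (h2 : ∀ t, 0 ≤ t → ∀ᶠ n in (U : Filter ι), dist (f n t) (ρ t) ≤ C)
    (h3 : ∀ t, 0 ≤ t → ∀ᶠ n in (U : Filter ι), dist (f n (-t)) (ζ t) ≤ C) :
    ∃ w : GeodesicLine X, w.neg = ξ ∧ w.pos = η ∧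
      ∀ t, Tendsto (fun n => f n t) U (𝓝 (w t)) := by
  obtain ⟨w, hw⟩ := exists_ultrafilter_limit U f (fun t => if 0 ≤ t then ρ t else ζ (-t))
    (fun _ => C) (by
      intro t
      split_ifs with ht
      · exact h2 t ht
      · simpa using h3 (-t) (by linarith))
  have hiso : Isometry w := Isometry.of_dist_eq fun s t => by
    refine tendsto_nhds_unique ((hw s).dist (hw t)) ?_
    refine tendsto_const_nhds.congr' ?_
    filter_upwards [h1 (max (-s) (-t))] with n hn
    rw [hn s (by have := le_max_left (-s) (-t); simp only [mem_Ici]; linarith) t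
      (by have := le_max_right (-s) (-t); simp only [mem_Ici]; linarith), Real.dist_eq]
  refine ⟨⟨w, hiso⟩, GeodesicLine.endsAt_neg.1 (hζ.of_bounded (D := C) fun t ht => ?_),
    GeodesicLine.endsAt_pos.1 (hρ.of_bounded (D := C) fun t ht => ?_), hw⟩
  · exact le_of_tendsto ((hw (-t)).dist tendsto_const_nhds) (h3 t ht)
  · exact le_of_tendsto ((hw t).dist tendsto_const_nhds) (h2 t ht)

end Metric

/-! ### Asymptotic rays and lines; existence of rays -/

section Hadamard

variable {X : Type*} [MetricSpace X] [HadamardSpace X]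

theorem EndsAt.dist_le {c c' : ℝ → X} {η : Boundary X} (h : EndsAt c η) (h' : EndsAt c' η)
    (hc : IsometricOn c (Ici 0)) (hc' : IsometricOn c' (Ici 0)) {t : ℝ} (ht : 0 ≤ t) :
    dist (c t) (c' t) ≤ dist (c 0) (c' 0) := by
  obtain ⟨C, hC⟩ := h.bounded h'
  exact dist_le_of_bounded hc hc' hC ht

/-- The monotonicity for asymptotic rays, applied to the half-lines that begin at time `s`. This and
its mirror image for `neg` turn asymptotic information into information at finite times. -/
theorem GeodesicLine.dist_le_of_pos_eq {u v : GeodesicLine X} (h : u.pos = v.pos) {s t : ℝ}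
    (hst : s ≤ t) : dist (u t) (v t) ≤ dist (u s) (v s) := by
  have k := EndsAt.dist_le (c := flow s u) (c' := flow s v) (endsAt_pos.2 (flow_pos s u))
    (endsAt_pos.2 ((flow_pos s v).trans h.symm)) (isometricOn _ _) (isometricOn _ _)
    (sub_nonneg.2 hst)
  simpa [flow] using k

theorem GeodesicLine.dist_le_of_neg_eq {u v : GeodesicLine X} (h : u.neg = v.neg) {s t : ℝ}
    (hst : t ≤ s) : dist (u t) (v t) ≤ dist (u s) (v s) := by
  have k := EndsAt.dist_le (c := fun t => flow s u (-t)) (c' := fun t => flow s v (-t))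
    (endsAt_neg.2 (flow_neg s u)) (endsAt_neg.2 ((flow_neg s v).trans h.symm))
    (isometricOn_neg _ _) (isometricOn_neg _ _) (sub_nonneg.2 hst)
  simpa [flow] using k

/-- Every point is joined to every boundary point by a ray. -/
theorem exists_ray [ProperSpace X] (p : X) (η : Boundary X) :
    ∃ c : ℝ → X, IsometricOn c (Ici 0) ∧ c 0 = p ∧ EndsAt c η := by
  set τ : GeodesicRay X := Quotient.out η
  choose c hc0 hc1 hc using fun n : ℕ => exists_isometricOn p (τ n)
  set D := dist p (τ 0)
  have hlen : ∀ n : ℕ, (n : ℝ) - D ≤ dist p (τ n) := by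
    intro n
    have h := dist_triangle_left (τ 0) (τ n) p
    rw [τ.isometry.dist_eq, NNReal.dist_eq] at h
    simp only [NNReal.coe_zero, NNReal.coe_natCast, zero_sub, abs_neg, Nat.abs_cast] at h
    linarith
  have hfar : ∀ T : ℝ, ∀ᶠ n : ℕ in (hyperfilter ℕ : Filter ℕ), T ≤ n ∧ T ≤ dist p (τ n) := by
    intro T
    refine Filter.Eventually.filter_mono Nat.hyperfilter_le_atTop ?_
    filter_upwards [tendsto_natCast_atTop_atTop.eventually_ge_atTop (T + D)] with n hn
    have := hlen n
    have : 0 ≤ D := dist_nonneg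
    constructor <;> linarith
  -- The segment from `p` and the ray `τ` share the end point `τ n` and start at distance `D`, so
  -- fellow travelling applies with error `0` at the far end.
  have hb : ∀ t : ℝ≥0, ∀ᶠ n : ℕ in (hyperfilter ℕ : Filter ℕ), dist (c n t) (τ t) ≤ 2 * D := by
    intro t
    filter_upwards [hfar t] with n hn
    have := dist_le_fellow_travel' (c := c n) (c' := τ.extend) (D := D) (E := 0) (b := n)
      dist_nonneg (Nat.cast_nonneg n) (hc n) (τ.isometricOn.mono fun s hs => hs.1) t.2 hn.2 hn.1
      (by simp [hc0, GeodesicRay.extend, D]) (by simp [hc1, GeodesicRay.extend])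
    simpa [GeodesicRay.extend] using this
  obtain ⟨w, hw⟩ := exists_ultrafilter_limit (hyperfilter ℕ) (fun n (t : ℝ≥0) => c n t) (fun t => τ t)
    (fun _ => 2 * D) hb
  refine ⟨fun t => w t.toNNReal, ?_, ?_, 2 * D, fun t => ?_⟩
  · intro s hs t ht
    refine tendsto_nhds_unique ((hw _).dist (hw _)) (tendsto_const_nhds.congr' ?_)
    filter_upwards [hfar (max s t)] with n hn
    rw [Real.coe_toNNReal _ hs, Real.coe_toNNReal _ ht,
      hc n s ⟨hs, (le_max_left _ _).trans hn.2⟩ t ⟨ht, (le_max_right _ _).trans hn.2⟩]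
  · refine tendsto_nhds_unique (hw _) (tendsto_const_nhds.congr fun n => ?_)
    simp [hc0]
  · show dist (w (t : ℝ).toNNReal) (τ t) ≤ 2 * D
    rw [Real.toNNReal_coe]
    exact le_of_tendsto ((hw t).dist tendsto_const_nhds) (hb t)

end Hadamard

end CAT0

namespace CAT0

/-! ### Busemann functions along lines -/

section Busemann

variable {X : Type*} [MetricSpace X]

theorem busemann_add (ξ : Boundary X) (x y z : X) :
    busemann ξ x y + busemann ξ y z = busemann ξ x z :=
  tendsto_nhds_unique (((tendsto_busemann ξ x y).add (tendsto_busemann ξ y z)).congr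
    fun s => by ring) (tendsto_busemann ξ x z)

theorem busemann_le_dist (ξ : Boundary X) (x y : X) : busemann ξ x y ≤ dist x y :=
  le_of_tendsto' (tendsto_busemann ξ x y) fun s => by
    linarith [dist_triangle x y ((Quotient.out ξ : GeodesicRay X) s)]

theorem continuous_busemann (ξ : Boundary X) (y : X) : Continuous fun x => busemann ξ x y := by
  refine (LipschitzWith.of_le_add fun a b => ?_ : LipschitzWith 1 _).continuous
  rw [← busemann_add ξ a b y]
  linarith [busemann_le_dist ξ a b]

/-- Along a line starting at `ξ`, the Busemann function of `ξ` is the arc length up to a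
bounded error. -/
theorem GeodesicLine.exists_busemann_bound (w : GeodesicLine X) :
    ∃ C, ∀ a, |busemann w.neg (w a) (w 0) - a| ≤ C := by
  obtain ⟨C, hC⟩ := endsAt_neg.2 (rfl : w.neg = w.neg)
  refine ⟨2 * C, fun a => ?_⟩
  have h := ((tendsto_busemann w.neg (w a) (w 0)).sub_const a).abs
  refine le_of_tendsto h ?_
  -- For `s ≥ -a` the point `w (-s)` lies behind both `w a` and `w 0` once `s ≥ 0`, so the two
  -- distances are `a + s` and `s`. Replacing `w (-s)` by `q` changes each by at most `C`.
  filter_upwards [eventually_ge_atTop (-a).toNNReal] with s hs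
  have hs' : 0 ≤ a + s := by have := Real.toNNReal_le_iff_le_coe.1 hs; linarith
  set q := (Quotient.out w.neg : GeodesicRay X) s
  have h0 : dist (w (-s)) q ≤ C := hC s
  have d1 : dist (w a) (w (-s)) = a + s := by
    rw [w.isometry.dist_eq, Real.dist_eq, sub_neg_eq_add, abs_of_nonneg hs']
  have d2 : dist (w 0) (w (-s)) = s := by
    rw [w.isometry.dist_eq, Real.dist_eq, sub_neg_eq_add, zero_add, NNReal.abs_eq]
  have t1 := dist_triangle (w a) (w (-s)) q
  have t2 := dist_triangle (w 0) (w (-s)) q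
  have t3 := dist_triangle_right (w a) (w (-s)) q
  have t4 := dist_triangle_right (w 0) (w (-s)) q
  rw [abs_le]
  constructor <;> linarith

/-- Up to a bounded error the function grows like `a`, so it takes both signs and the intermediate
value theorem applies. It serves to match the third Hopf parameter of two parallel lines by a shift.
-/
theorem GeodesicLine.exists_busemann_eq_zero (w : GeodesicLine X) (y : X) :
    ∃ a, busemann w.neg (w a) y = 0 := by
  obtain ⟨C, hC⟩ := w.exists_busemann_bound
  have hcont : Continuous fun a => busemann w.neg (w a) y :=
    (continuous_busemann _ y).comp w.isometry.continuous
  set B := busemann w.neg (w 0) y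
  have hsum : ∀ a, busemann w.neg (w a) y = busemann w.neg (w a) (w 0) + B := fun a =>
    (busemann_add _ _ _ _).symm
  refine mem_range_of_exists_le_of_exists_ge hcont ⟨-(C + B), ?_⟩ ⟨C - B, ?_⟩
  · have := (abs_le.1 (hC (-(C + B)))).2
    rw [hsum]; linarith
  · have := (abs_le.1 (hC (C - B))).1
    rw [hsum]; linarith

/-- Convergence in `d₁` implies pointwise convergence, the only form in which recurrence is used. -/
theorem GeodesicLine.dist_le_d₁ (u v : GeodesicLine X) (t : ℝ) :
    dist (v t) (u t) ≤ Real.exp |t| * d₁ u v := by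
  have h := le_ciSup (bddAbove_d₁ u v) t
  calc dist (v t) (u t) = Real.exp |t| * (Real.exp (-|t|) * dist (v t) (u t)) := by
        rw [← mul_assoc, ← Real.exp_add]; simp
    _ ≤ _ := by gcongr; exact h

end Busemann

/-! ### Rigidity of lines ending in `∂X^rec` -/

section Hadamard

variable {X : Type*} [MetricSpace X] [HadamardSpace X]

namespace GeodesicLine

/-- A line parallel to a line of zero width is a reparametrization of it. -/
theorem IsZeroWidth.exists_shift {v w : GeodesicLine X} (hv : v.IsZeroWidth) (hn : w.neg = v.neg)
    (hp : w.pos = v.pos) : ∃ a, ∀ t, w (t + a) = v t := by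
  obtain ⟨a, ha⟩ := w.exists_busemann_eq_zero (v 0)
  have hH : HopfEquiv (flow a w) v := by
    intro x
    have : busemann v.neg (w a) x = busemann v.neg (v 0) x := by
      rw [← busemann_add v.neg (w a) (v 0) x, ← hn, ha, zero_add]
    simp only [hopf, flow_pos, flow_neg, hn, hp]
    simpa [flow] using this
  -- Both the shifted line and `v` itself compete in the supremum, so zero width forces them to
  -- agree at time `0`. Monotonicity then spreads this to both half-lines.
  have h0 : edist (flow a w 0) (v 0) ≤ v.width :=
    le_iSup₂_of_le (flow a w) hH (le_iSup₂_of_le v (fun _ => rfl) le_rfl)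
  rw [hv.2, nonpos_iff_eq_zero, edist_eq_zero] at h0
  refine ⟨a, fun t => dist_le_zero.1 ?_⟩
  show dist (flow a w t) (v t) ≤ 0
  rcases le_total 0 t with ht | ht
  · simpa [h0] using dist_le_of_pos_eq ((flow_pos a w).trans hp) ht
  · simpa [h0] using dist_le_of_neg_eq ((flow_neg a w).trans hn) ht

/-- Lines that end at the end point of a recurrent line of zero width are strongly asymptotic
to it. -/
theorem IsRecurrent.exists_tendsto_dist [ProperSpace X] {G : Subgroup (X ≃ᵢ X)}
    {u v : GeodesicLine X} (hr : v.IsRecurrent G) (hv : v.IsZeroWidth) (hp : u.pos = v.pos) :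
    ∃ a, Tendsto (fun t => dist (u t) (v (t + a))) atTop (𝓝 0) := by
  obtain ⟨g, τ, -, hτ, hlim⟩ := hr
  have hlim' : ∀ s, Tendsto (fun n => dist (v s) (g n (v (s + τ n)))) atTop (𝓝 0) := by
    intro s
    have h := hlim.const_mul (Real.exp |s|)
    rw [mul_zero] at h
    exact squeeze_zero (fun _ => dist_nonneg)
      (fun n => dist_le_d₁ (translate (g n) (flow (τ n) v)) v s) h
  have hle : ((hyperfilter ℕ : Ultrafilter ℕ) : Filter ℕ) ≤ atTop := Nat.hyperfilter_le_atTop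
  have hb : ∀ s, ∀ᶠ n in ((hyperfilter ℕ : Ultrafilter ℕ) : Filter ℕ),
      dist (g n (u (s + τ n))) (v s) ≤ dist (u 0) (v 0) + 1 := by
    intro s
    refine Eventually.filter_mono hle ?_
    filter_upwards [(hlim' s).eventually (ge_mem_nhds zero_lt_one),
      hτ.eventually_ge_atTop (-s)] with n hn hn'
    have h1 := dist_triangle_right (g n (u (s + τ n))) (v s) (g n (v (s + τ n)))
    rw [(g n).isometry.dist_eq] at h1
    have h2 := dist_le_of_pos_eq hp (by linarith : 0 ≤ s + τ n)
    linarith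
  -- The moved copies of `u` stay at bounded distance from `v`, so their limit `w` is parallel to
  -- `v`.
  obtain ⟨w, hwn, hwp, hw⟩ := exists_line_limit (hyperfilter ℕ)
    (f := fun n t => g n (u (t + τ n))) (endsAt_neg.2 rfl) (endsAt_pos.2 rfl)
    (fun T => Eventually.of_forall fun n =>
      isometricOn (translate (g n) (flow (τ n) u)) _)
    (fun t _ => hb t) (fun t _ => hb (-t))
  obtain ⟨a, ha⟩ := hv.exists_shift hwn hwp
  have hw0 : w 0 = v (-a) := by rw [← ha]; simp
  -- A monotone distance has a limit, so it is enough to compute it at the times `τ n` along the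
  -- ultrafilter. There `g n` carries the two points to points tending to `w 0` and `v (-a)`, which
  -- are equal.
  have hmono : Antitone fun t => dist (u t) (v (t + -a)) := fun s t hst =>
    dist_le_of_pos_eq (v := flow (-a) v) (hp.trans (flow_pos _ _).symm) hst
  have hinf := tendsto_atTop_ciInf hmono ⟨0, by rintro _ ⟨t, rfl⟩; exact dist_nonneg⟩
  have hzero : Tendsto (fun n => dist (u (τ n)) (v (τ n + -a)))
      ((hyperfilter ℕ : Ultrafilter ℕ) : Filter ℕ) (𝓝 0) := by
    have k1 := (hw 0).dist (tendsto_const_nhds (x := w 0))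
    rw [dist_self] at k1
    have k2 := k1.add ((hlim' (-a)).mono_left hle)
    rw [add_zero] at k2
    refine squeeze_zero (fun _ => dist_nonneg) (fun n => ?_) k2
    have h1 := dist_triangle (g n (u (0 + τ n))) (w 0) (g n (v (-a + τ n)))
    rw [(g n).isometry.dist_eq, zero_add, add_comm (-a)] at h1
    rw [zero_add, add_comm (-a), ← hw0]
    exact h1
  have := tendsto_nhds_unique hzero (hinf.comp (hτ.mono_left hle))
  exact ⟨-a, by rw [this]; exact hinf⟩

end GeodesicLine

open GeodesicLine in
/-- A line that ends in `∂X^rec` is determined by its end points up to parametrization. -/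
theorem exists_shift_of_mem_recBoundary [ProperSpace X] {u w : GeodesicLine X}
    (hη : u.pos ∈ recBoundary X) (hn : w.neg = u.neg) (hp : w.pos = u.pos) :
    ∃ a, w a = u 0 := by
  obtain ⟨v, hv, hr, hvp⟩ := hη
  obtain ⟨a, ha⟩ := hr.exists_tendsto_dist hv hvp
  obtain ⟨b, hb⟩ := hr.exists_tendsto_dist hv (hp.trans hvp)
  refine ⟨a - b, ?_⟩
  -- After the shift by `a - b` both lines are asymptotic to the same parametrization of `v`, so
  -- their distance tends to `0` forwards; the common negative end point bounds the distance at time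
  -- `0` by each of these.
  have h1 := (hb.comp (tendsto_atTop_add_const_right atTop (a - b) tendsto_id)).add ha
  rw [add_zero] at h1
  refine dist_le_zero.1 (ge_of_tendsto h1 ?_)
  filter_upwards [eventually_ge_atTop 0] with t ht
  have h2 := dist_le_of_neg_eq (u := flow (a - b) w) (v := u) ((flow_neg _ _).trans hn) ht
  simp only [flow, zero_add] at h2
  refine h2.trans ?_
  have h3 := dist_triangle_right (w (t + (a - b))) (u t) (v (t + a))
  simpa [add_assoc] using h3

end Hadamard

end CAT0

namespace CAT0

/-! ### Limits of rays, and rays passing near a rigid line -/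

section Limits

variable {X : Type*} [MetricSpace X] [HadamardSpace X]

/-- Asymptotic rays do not diverge, so the distance from `o` to the ray towards `η` is a 1-Lipschitz
function of the starting point. This supplies the continuity for the intermediate value argument. -/
theorem infDist_ray_le {ρ ρ' : ℝ → X} {η : Boundary X} (hρ : IsometricOn ρ (Ici 0))
    (hρ' : IsometricOn ρ' (Ici 0)) (h : EndsAt ρ η) (h' : EndsAt ρ' η) (o : X) :
    Metric.infDist o (ρ '' Ici 0) ≤ Metric.infDist o (ρ' '' Ici 0) + dist (ρ 0) (ρ' 0) := by
  refine le_of_forall_pos_lt_add fun e he => ?_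
  obtain ⟨_, ⟨t, ht, rfl⟩, hy⟩ := (Metric.infDist_lt_iff (s := ρ' '' Ici 0) (x := o)
    (nonempty_Ici.image _)).1 (lt_add_of_pos_right _ he)
  have h1 := Metric.infDist_le_dist_of_mem (x := o) (mem_image_of_mem ρ ht)
  have h2 := EndsAt.dist_le h h' hρ hρ' ht
  linarith [dist_triangle_right o (ρ t) (ρ' t)]

variable [ProperSpace X]

/-- Rays to `η` that start at points tending to `ξ` and pass at bounded distance from `o`
accumulate on a line from `ξ` to `η`. -/
theorem exists_line_limit_of_rays {ι : Type*} (U : Ultrafilter ι) {ρ c : ι → ℝ → X} {a b : ι → ℝ}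
    {o : X} {ξ η : Boundary X} {ζ : ℝ → X} {R C : ℝ} (hζ : EndsAt ζ ξ)
    (hρ : ∀ n, IsometricOn (ρ n) (Ici 0)) (hρη : ∀ n, EndsAt (ρ n) η)
    (ha : ∀ n, 0 ≤ a n) (hc : ∀ n, IsometricOn (c n) (Icc 0 (a n))) (hc0 : ∀ n, c n 0 = o)
    (hca : ∀ n, c n (a n) = ρ n 0) (hb : ∀ n, 0 ≤ b n) (hR : ∀ n, dist (ρ n (b n)) o ≤ R)
    (hfar : ∀ t, 0 ≤ t → ∀ᶠ n in (U : Filter ι), t ≤ a n ∧ dist (c n t) (ζ t) ≤ C) :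
    ∃ w : GeodesicLine X, w.neg = ξ ∧ w.pos = η ∧
      ∀ t, Tendsto (fun n => ρ n (b n + t)) U (𝓝 (w t)) := by
  obtain ⟨κ, hκ, hκ0, hκη⟩ := exists_ray o η
  -- The starting points escape from `o` while `ρ n (b n)` stays near it; hence `b n → ∞`, and the
  -- shifted rays are defined on ever longer negative intervals.
  have hab : ∀ n, a n ≤ b n + R := by
    intro n
    have h1 := dist_triangle_left (c n 0) (c n (a n)) (ρ n (b n))
    rw [hc n 0 ⟨le_rfl, ha n⟩ _ ⟨ha n, le_rfl⟩, hca, hc0, hρ n _ (hb n) 0 self_mem_Ici,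
      zero_sub, abs_neg, abs_of_nonneg (ha n), sub_zero, abs_of_nonneg (hb n)] at h1
    linarith [hR n]
  have hbfar : ∀ T, ∀ᶠ n in (U : Filter ι), T ≤ b n := by
    intro T
    filter_upwards [hfar (max 0 (T + R)) (le_max_left _ _)] with n hn
    linarith [hab n, le_max_right 0 (T + R)]
  refine exists_line_limit U (C := max R (2 * R + C)) hζ hκη (fun T => ?_) (fun t ht => ?_)
    (fun t ht => ?_)
  · filter_upwards [hbfar T] with n hn
    exact (hρ n).shift (b n) fun t ht => by
      simp only [mem_Ici] at ht ⊢
      linarith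
  · refine Eventually.of_forall fun n => le_max_of_le_left ?_
    refine (EndsAt.dist_le ((hρη n).comp_add (hρ n) (hb n)) hκη ?_ hκ ht).trans ?_
    · exact (hρ n).shift (b n) fun t ht => add_nonneg (hb n) ht
    · simpa [hκ0] using hR n
  · filter_upwards [hbfar t, hfar t ht] with n hn hn'
    refine le_max_of_le_right ?_
    -- Run backwards from `b n`, the ray `ρ n` begins within `R` of `o` and ends where `c n` ends,
    -- so it follows `c n` and hence `ζ`.
    have h := dist_le_fellow_travel' (c := fun t => ρ n (b n - t)) (c' := c n) (D := R) (E := 0)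
      (hb n) (ha n) (IsometricOn.reverse (a := b n) ((hρ n).mono fun s hs => by simpa using hs.1))
      (hc n) ht hn hn'.1 (by simpa [hc0] using hR n) (by simp [hca])
    rw [← sub_eq_add_neg]
    linarith [dist_triangle (ρ n (b n - t)) (c n t) (ζ t), hn'.2]

open GeodesicLine in
/-- Rays from points near `u⁻` to `u⁺` pass close to `u(0)`, if `u⁺ ∈ ∂X^rec`. -/
theorem exists_forall_ray_near {u : GeodesicLine X} (hu : u.pos ∈ recBoundary X) {ε : ℝ}
    (hε : 0 < ε) : ∃ T, 0 ≤ T ∧ ∀ (a : ℝ) (c ρ : ℝ → X), T ≤ a → IsometricOn c (Icc 0 a) →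
      c 0 = u 0 → dist (c T) (u (-T)) < 1 → IsometricOn ρ (Ici 0) → ρ 0 = c a →
      EndsAt ρ u.pos → ∃ t, 0 ≤ t ∧ dist (ρ t) (u 0) < ε := by
  by_contra! hcon
  choose a c ρ haN hc hc0 hcN hρ hρ0 hρη hfar using fun n : ℕ =>
    hcon ((n : ℝ) + 1) (by positivity)
  have ha : ∀ n, 0 ≤ a n := fun n => le_trans (by positivity) (haN n)
  choose R hR hR0 hRη using fun p : X => exists_ray p u.pos
  set o := u 0
  set F : X → ℝ := fun p => Metric.infDist o (R p '' Ici 0)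
  have hF : ∀ p (κ : ℝ → X), IsometricOn κ (Ici 0) → EndsAt κ u.pos → κ 0 = p → ∀ t, 0 ≤ t →
      F p ≤ dist o (κ t) := by
    intro p κ hκ hκη hκ0 t ht
    have h := infDist_ray_le (hR p) hκ (hRη p) hκη o
    rw [hR0, hκ0, dist_self, add_zero] at h
    exact h.trans (Metric.infDist_le_dist_of_mem (mem_image_of_mem κ ht))
  have hFL : ∀ p q, F p ≤ F q + dist p q := by
    intro p q
    simpa [hR0] using infDist_ray_le (hR p) (hR q) (hRη p) (hRη q) o
  have hFu : ∀ s, 0 ≤ s → F (u (-s)) = 0 := by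
    intro s hs
    refine le_antisymm ?_ Metric.infDist_nonneg
    have := hF (u (-s)) (flow (-s) u) (isometricOn _ _) (endsAt_pos.2 (flow_pos _ _))
      (by simp [flow]) s hs
    simpa [flow, o] using this
  have hFc : Continuous F := (LipschitzWith.of_le_add hFL).continuous
  -- The rays `ρ n` themselves may stray arbitrarily far from `o`. An intermediate starting point on
  -- `c n` gives a ray at distance exactly `ε`: bounded, so that limits exist, yet not close to `o`.
  have hmid : ∀ n, ∃ s ∈ Icc 0 (a n), F (c n s) = ε := by
    intro n
    have hcont : ContinuousOn (c n) (Icc 0 (a n)) := by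
      refine LipschitzOnWith.continuousOn (K := 1) (LipschitzOnWith.of_dist_le_mul ?_)
      intro s hs t ht
      rw [hc n s hs t ht, Real.dist_eq, NNReal.coe_one, one_mul]
    refine intermediate_value_Icc (ha n) (hFc.comp_continuousOn hcont) ⟨?_, ?_⟩
    · have := hFu 0 le_rfl
      rw [neg_zero] at this
      simp only [Function.comp, hc0]
      exact this.trans_le hε.le
    · show ε ≤ F (c n (a n))
      have h := infDist_ray_le (hρ n) (hR (c n (a n))) (hρη n) (hRη _) o
      rw [hR0, hρ0, dist_self, add_zero] at h
      refine le_trans ?_ h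
      rw [Metric.le_infDist (nonempty_Ici.image _)]
      rintro _ ⟨t, ht, rfl⟩
      rw [dist_comm]
      exact hfar n t ht
  choose s hs hsε using hmid
  have hclose : ∀ (n : ℕ) (t : ℝ), 0 ≤ t → t ≤ n + 1 → dist (c n t) (u (-t)) ≤ t / (n + 1) := by
    intro n t ht htn
    have hn : (0 : ℝ) < n + 1 := by positivity
    have h := dist_le_mul_of_common_start (c := c n) (c' := fun t => u (-t)) (l := t / (n + 1))
      hn.le hn.le ((hc n).mono (Icc_subset_Icc_right (haN n))) (isometricOn_neg u _)
      (by simp [hc0, o]) ⟨by positivity, by rw [div_le_one hn]; exact htn⟩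
    rw [div_mul_cancel₀ _ hn.ne'] at h
    refine h.trans (mul_le_of_le_one_right (by positivity) (hcN n).le)
  -- `F` vanishes on the negative half of `u`, which `c n` follows up to `t / (n + 1)`. As `F` is
  -- 1-Lipschitz, the value `ε` is not reached early, so `s n → ∞`.
  have hsn : ∀ n, min ε 1 * (n + 1) ≤ s n := by
    intro n
    have hn : (0 : ℝ) < n + 1 := by positivity
    rcases le_total (s n) (n + 1) with h | h
    · have h1 := hFL (c n (s n)) (u (-s n))
      rw [hsε, hFu _ (hs n).1, zero_add] at h1
      have h2 := h1.trans (hclose n _ (hs n).1 h)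
      rw [le_div_iff₀ hn] at h2
      exact (mul_le_mul_of_nonneg_right (min_le_left _ _) hn.le).trans h2
    · refine le_trans ?_ h
      exact mul_le_of_le_one_left hn.le (min_le_right _ _)
  have hb : ∀ n, ∃ t, 0 ≤ t ∧ dist (R (c n (s n)) t) o ≤ 2 * ε := by
    intro n
    obtain ⟨_, ⟨t, ht, rfl⟩, hy⟩ := (Metric.infDist_lt_iff (s := R (c n (s n)) '' Ici 0) (x := o)
      (nonempty_Ici.image _)).1 ((hsε n).trans_lt (by linarith : ε < 2 * ε))
    exact ⟨t, ht, by rw [dist_comm]; exact hy.le⟩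
  choose b hb0 hb using hb
  have hle : ((hyperfilter ℕ : Ultrafilter ℕ) : Filter ℕ) ≤ atTop := Nat.hyperfilter_le_atTop
  have hlarge : ∀ T, ∀ᶠ n : ℕ in ((hyperfilter ℕ : Ultrafilter ℕ) : Filter ℕ),
      T ≤ s n ∧ T ≤ (n : ℝ) + 1 := by
    intro T
    have hm : 0 < min ε 1 := lt_min hε one_pos
    refine Eventually.filter_mono hle ?_
    filter_upwards [tendsto_natCast_atTop_atTop.eventually_ge_atTop T,
      tendsto_natCast_atTop_atTop.eventually_ge_atTop (T / min ε 1)] with n h1 h2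
    rw [div_le_iff₀' hm] at h2
    constructor <;> nlinarith [hsn n]
  obtain ⟨w, hwn, hwp, hw⟩ := exists_line_limit_of_rays (hyperfilter ℕ) (o := o) (C := 1)
    (ρ := fun n => R (c n (s n))) (c := c) (a := s) (b := b) (endsAt_neg.2 (rfl : u.neg = u.neg))
    (fun n => hR _) (fun n => hRη _) (fun n => (hs n).1)
    (fun n => (hc n).mono (Icc_subset_Icc_right (hs n).2)) hc0 (fun n => (hR0 _).symm) hb0 hb
    (by
      intro t ht
      filter_upwards [hlarge t] with n hn
      exact ⟨hn.1, (hclose n t ht hn.2).trans (div_le_one_of_le₀ hn.2 (by positivity))⟩)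
  obtain ⟨e, he⟩ := exists_shift_of_mem_recBoundary hu hwn hwp
  have h1 := (tendsto_const_nhds (x := o)).dist (hw e)
  rw [he, dist_self] at h1
  refine hε.not_ge (ge_of_tendsto h1 ?_)
  -- Since `s n ≤ b n + 2 * ε`, this threshold makes `b n + e` nonnegative, so the point approaching
  -- `o` does lie on the ray.
  filter_upwards [hlarge (2 * ε + |e|)] with n hn
  refine (hsε n).symm.le.trans (Metric.infDist_le_dist_of_mem (mem_image_of_mem _ ?_))
  have h2 := dist_triangle_left (c n 0) (c n (s n)) (R (c n (s n)) (b n))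
  have h3 := hR (c n (s n)) _ (hb0 n) 0 self_mem_Ici
  rw [hR0, sub_zero, abs_of_nonneg (hb0 n)] at h3
  rw [hc n 0 ⟨le_rfl, ha n⟩ _ (hs n), hc0, h3, zero_sub, abs_neg, abs_of_nonneg (hs n).1] at h2
  have := hb n
  have := neg_abs_le e
  simp only [mem_Ici]
  linarith [hn.1]

end Limits

/-! ### Cone topology, shadows and the two inclusions -/

section Shadows

variable {X : Type*} [MetricSpace X]

/-- `σ`, restricted to `[0,∞)`, is a geodesic to `z` that does not arrive before time `S`. -/
def IsGeodesicBeyond (σ : ℝ → X) (S : ℝ) : Compactification X → Prop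
  | .pt y => ∃ L, S ≤ L ∧ IsometricOn σ (Icc 0 L) ∧ σ L = y
  | .bd ξ => IsometricOn σ (Ici 0) ∧ EndsAt σ ξ

theorem IsGeodesicBeyond.isometricOn {σ : ℝ → X} {S : ℝ} {z : Compactification X}
    (h : IsGeodesicBeyond σ S z) : IsometricOn σ (Icc 0 S) := by
  cases z with
  | pt y =>
    obtain ⟨L, hL, h, -⟩ := h
    exact h.mono (Icc_subset_Icc_right hL)
  | bd ξ => exact h.1.mono fun s hs => hs.1

/-- Convergence to a boundary point in the cone topology, in terms of geodesics. -/
theorem eventually_exists_isGeodesicBeyond {z : ℕ → Compactification X} {ξ : Boundary X}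
    (hz : Tendsto z atTop (𝓝 (Compactification.bd ξ))) {ζ : ℝ → X}
    (hζ : IsometricOn ζ (Ici 0)) (hζξ : EndsAt ζ ξ) {S : ℝ} (hS : 0 ≤ S) :
    ∀ᶠ n in atTop, ∃ σ : ℝ → X, σ 0 = ζ 0 ∧ IsGeodesicBeyond σ S (z n) ∧
      dist (σ S) (ζ S) ≤ 3 := by
  -- Testing at time `S + 1` with radius `1` excludes that the geodesic arrives before time `S`: it
  -- would then be constant at a point at distance `< S` from `ζ 0`, whereas `ζ (S + 1)` has
  -- distance `S + 1`.
  have hopen : IsOpen {y : Compactification X | ∃ σ : ℝ≥0 → X, IsGeodesicTo σ (ζ 0) y ∧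
      σ (S + 1).toNNReal ∈ Metric.ball (ζ (S + 1)) 1} :=
    TopologicalSpace.isOpen_generateFrom_of_mem ⟨_, _, _, Metric.isOpen_ball, rfl⟩
  have hS1 : (0 : ℝ) ≤ S + 1 := by linarith
  have hmem : Compactification.bd ξ ∈ {y : Compactification X | ∃ σ : ℝ≥0 → X,
      IsGeodesicTo σ (ζ 0) y ∧ σ (S + 1).toNNReal ∈ Metric.ball (ζ (S + 1)) 1} := by
    refine ⟨fun t => ζ t, ⟨GeodesicRay.ofCurve ζ hζ, rfl, rfl,
      GeodesicRay.endpoint_ofCurve.2 hζξ⟩, ?_⟩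
    simp [Real.coe_toNNReal _ hS1]
  have hζ1 : dist (ζ (S + 1)) (ζ S) = 1 := by
    rw [hζ _ hS1 _ hS]; simp
  filter_upwards [hz.eventually (hopen.mem_nhds hmem)] with n hn
  obtain ⟨σ, hσ, hball⟩ := hn
  rw [Metric.mem_ball] at hball
  have step : dist (σ S.toNNReal) (σ (S + 1).toNNReal) ≤ 1 →
      dist (σ S.toNNReal) (ζ S) ≤ 3 := fun h => by
    linarith [dist_triangle4 (σ S.toNNReal) (σ (S + 1).toNNReal) (ζ (S + 1)) (ζ S)]
  refine ⟨fun t => σ t.toNNReal, ?_⟩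
  cases hzn : z n with
  | pt y =>
    rw [hzn] at hσ
    obtain ⟨h0, h1, h2⟩ := hσ
    have hiso : IsometricOn (fun t : ℝ => σ t.toNNReal) (Icc 0 (dist (ζ 0) y)) := by
      intro s hs t ht
      rw [h1 _ _ (by rw [Real.coe_toNNReal _ hs.1]; exact hs.2)
        (by rw [Real.coe_toNNReal _ ht.1]; exact ht.2), NNReal.dist_eq,
        Real.coe_toNNReal _ hs.1, Real.coe_toNNReal _ ht.1]
    have hend : σ (dist (ζ 0) y).toNNReal = y := h2 _ (by rw [Real.coe_toNNReal _ dist_nonneg])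
    have hlen : S ≤ dist (ζ 0) y := by
      by_contra! hlt
      rw [h2 _ (by rw [Real.coe_toNNReal _ hS1]; linarith)] at hball
      have h3 := hζ 0 self_mem_Ici _ hS1
      rw [zero_sub, abs_neg, abs_of_nonneg hS1] at h3
      linarith [dist_triangle (ζ 0) y (ζ (S + 1))]
    refine ⟨by simpa using h0, ⟨_, hlen, hiso, hend⟩, step ?_⟩
    rcases le_total (S + 1) (dist (ζ 0) y) with h | h
    · have := hiso S ⟨hS, hlen⟩ (S + 1) ⟨hS1, h⟩
      simp only at this
      rw [this]; simp
    · rw [h2 (S + 1).toNNReal (by rw [Real.coe_toNNReal _ hS1]; exact h)]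
      have := hiso S ⟨hS, hlen⟩ _ ⟨dist_nonneg, le_rfl⟩
      simp only [hend] at this
      rw [this, abs_le]
      constructor <;> linarith
  | bd ξ' =>
    rw [hzn] at hσ
    obtain ⟨τ, rfl, h0, h1⟩ := hσ
    have hiso := τ.isometricOn
    refine ⟨by simpa using h0, ⟨hiso, GeodesicRay.endsAt_extend.2 h1⟩, step ?_⟩
    have := hiso S hS (S + 1) hS1
    rw [GeodesicRay.extend, GeodesicRay.extend] at this
    rw [this]; simp

theorem smallShadow_subset_largeShadow {r : ℝ} (hr : 0 < r) (z : Compactification X) (x : X) :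
    smallShadow r z x ⊆ largeShadow r z x := by
  cases z with
  | pt y => exact fun η h => ⟨y, Metric.mem_ball_self hr, h y (Metric.mem_ball_self hr)⟩
  | bd ξ => exact subset_rfl

variable [HadamardSpace X]

/-- A point of the large shadow of `z` is the end point of a ray which passes close to `x` and
starts at a point close to the geodesic from `x` to `z`, at distance about `N` if
`z` is a boundary point. -/
theorem exists_ray_of_mem_largeShadow {r : ℝ} {z : Compactification X} {x : X}
    {η : Boundary X} (hη : η ∈ largeShadow r z x) {N : ℝ} (hN : 0 ≤ N) :
    ∃ (ρ c : ℝ → X) (a b : ℝ), IsometricOn ρ (Ici 0) ∧ EndsAt ρ η ∧ 0 ≤ a ∧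
      IsometricOn c (Icc 0 a) ∧ c 0 = x ∧ c a = ρ 0 ∧ 0 ≤ b ∧ dist (ρ b) x ≤ r ∧
      ∀ t (σ : ℝ → X), 0 ≤ t → σ 0 = x → IsGeodesicBeyond σ (t + r) z → t + r ≤ N →
        t ≤ a ∧ dist (c t) (σ t) ≤ 2 * r := by
  cases z with
  | pt y =>
    obtain ⟨y', hy', h⟩ := hη
    obtain ⟨ρ, hρ, hρ0, hρη, b, hb, hbx⟩ := rayMeetsBall_iff.1 h
    obtain ⟨c, hc0, hca, hc⟩ := exists_isometricOn x y'
    refine ⟨ρ, c, dist x y', b, hρ, hρη, dist_nonneg, hc, hc0, hca.trans hρ0.symm, hb, hbx.le, ?_⟩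
    rintro t σ ht h0 ⟨L, hL, hσ, rfl⟩ -
    rw [Metric.mem_ball] at hy'
    have hr : 0 < r := dist_nonneg.trans_lt hy'
    have hL0 : 0 ≤ L := by linarith
    have h1 := hσ 0 ⟨le_rfl, hL0⟩ L ⟨hL0, le_rfl⟩
    rw [h0, zero_sub, abs_neg, abs_of_nonneg hL0] at h1
    have hta : t ≤ dist x y' := by linarith [dist_triangle x y' (σ L)]
    refine ⟨hta, ?_⟩
    have := dist_le_fellow_travel' (D := 0) (E := r) dist_nonneg hL0 hc hσ ht hta (by linarith)
      (by simp [hc0, h0]) (by rw [hca]; exact hy'.le)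
    linarith
  | bd ξ =>
    obtain ⟨v, hvn, hvp, hvx⟩ := hη
    rw [Metric.mem_ball] at hvx
    obtain ⟨c, hc0, hca, hc⟩ := exists_isometricOn x (v (-N))
    refine ⟨fun t => GeodesicLine.flow (-N) v t, c, dist x (v (-N)), N,
      GeodesicLine.isometricOn _ _, GeodesicLine.endsAt_pos.2 ((GeodesicLine.flow_pos _ _).trans hvp),
      dist_nonneg, hc, hc0, by simp [hca, GeodesicLine.flow], hN,
      by simpa [GeodesicLine.flow] using hvx.le, ?_⟩
    rintro t σ ht h0 ⟨hσ, hσξ⟩ htN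
    have hr : 0 < r := dist_nonneg.trans_lt hvx
    have h1 : dist (v 0) (v (-N)) = N := by
      rw [v.isometry.dist_eq, Real.dist_eq, zero_sub, neg_neg, abs_of_nonneg hN]
    have hta : t ≤ dist x (v (-N)) := by linarith [dist_triangle (v 0) x (v (-N))]
    refine ⟨hta, ?_⟩
    have h2 := EndsAt.dist_le (GeodesicLine.endsAt_neg.2 hvn) hσξ
      (GeodesicLine.isometricOn_neg v _) hσ hN
    have := dist_le_fellow_travel' (D := 0) (E := r) dist_nonneg hN hc
      (hσ.mono fun s hs => hs.1) ht hta (by linarith)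
      (by simp [hc0, h0]) (by rw [hca]; exact h2.trans (by simpa [h0] using hvx.le))
    linarith

variable [ProperSpace X]

/-- If `z_n → ξ` and `η` lies in all shadows `O⁺_r(z_n,x)`, then a line from `ξ` to `η` meets the
closed ball. -/
theorem exists_line_of_forall_mem_largeShadow {ξ η : Boundary X} {x : X} {r : ℝ} (hr : 0 < r)
    {z : ℕ → Compactification X} (hz : Tendsto z atTop (𝓝 (Compactification.bd ξ)))
    (h : ∀ n, η ∈ largeShadow r (z n) x) :
    ∃ w : GeodesicLine X, w.neg = ξ ∧ w.pos = η ∧ dist (w 0) x ≤ r := by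
  choose ρ c a b hρ hρη ha hc hc0 hca hb hbx hσ using fun n : ℕ =>
    exists_ray_of_mem_largeShadow (h n) (Nat.cast_nonneg n)
  obtain ⟨ζ, hζ, hζ0, hζξ⟩ := exists_ray x ξ
  -- In the constant `2 * r + 6`, the first term is the distance from `c n` to the geodesic towards
  -- `z n`, and `6` is twice the error `3` between that geodesic and `ζ`.
  obtain ⟨w, hwn, hwp, hw⟩ := exists_line_limit_of_rays (hyperfilter ℕ) (C := 2 * r + 6) hζξ hρ hρη ha
    hc hc0 hca hb hbx (by
      intro t ht
      refine Eventually.filter_mono Nat.hyperfilter_le_atTop ?_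
      have htr : 0 ≤ t + r := by linarith
      filter_upwards [eventually_exists_isGeodesicBeyond hz hζ hζξ htr,
        tendsto_natCast_atTop_atTop.eventually_ge_atTop (t + r)] with n hn hn'
      obtain ⟨σ, hσ0, hσz, hσS⟩ := hn
      obtain ⟨h1, h2⟩ := hσ n t σ ht (hσ0.trans hζ0) hσz hn'
      refine ⟨h1, ?_⟩
      have h3 := dist_le_fellow_travel' (D := 0) (E := 3) htr htr hσz.isometricOn
        (hζ.mono fun s hs => hs.1) ht (by linarith) (by linarith) (by simp [hσ0]) hσS
      linarith [dist_triangle (c n t) (σ t) (ζ t)])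
  refine ⟨w, hwn, hwp, ?_⟩
  have h0 := hw 0
  simp only [add_zero] at h0
  exact le_of_tendsto' (h0.dist tendsto_const_nhds) hbx

theorem limsup_largeShadow_subset {ξ : Boundary X} {x : X} {r : ℝ} (hr : 0 < r)
    {z : ℕ → Compactification X} (hz : Tendsto z atTop (𝓝 (Compactification.bd ξ))) :
    limsup (fun n => largeShadow r (z n) x ∩ recBoundary X) atTop ⊆
      (shadow r ξ x ∪ shadowFrontier r ξ x) ∩ recBoundary X := by
  intro η hη
  rw [mem_limsup_iff_frequently_mem] at hη
  refine ⟨?_, hη.exists.choose_spec.2⟩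
  obtain ⟨φ, hφ, hmem⟩ := extraction_of_frequently_atTop hη
  obtain ⟨w, hwn, hwp, hwx⟩ := exists_line_of_forall_mem_largeShadow hr
    (hz.comp hφ.tendsto_atTop) fun n => (hmem n).1
  have hw : w 0 ∈ joinSet ξ η := ⟨w, hwn, hwp, rfl⟩
  have hle : Metric.infDist x (joinSet ξ η) ≤ r :=
    (Metric.infDist_le_dist_of_mem hw).trans (by rwa [dist_comm])
  rcases hle.eq_or_lt with heq | hlt
  · exact Or.inr ⟨⟨w, hwn, hwp⟩, heq⟩
  · obtain ⟨_, ⟨v, hvn, hvp, rfl⟩, hv⟩ := (Metric.infDist_lt_iff ⟨_, hw⟩).1 hlt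
    exact Or.inl ⟨v, hvn, hvp, by rwa [Metric.mem_ball, dist_comm]⟩

-- Geodesics from `u 0` to `z n` follow the negative half of `u` for a long time, so
-- `exists_forall_ray_near` applies to all sources near `z n` at once.
open GeodesicLine in
theorem eventually_mem_smallShadow {u : GeodesicLine X} (hu : u.pos ∈ recBoundary X) {x : X}
    {r : ℝ} (hr : 0 < r) (hux : dist (u 0) x < r) {z : ℕ → Compactification X}
    (hz : Tendsto z atTop (𝓝 (Compactification.bd u.neg))) :
    ∀ᶠ n in atTop, u.pos ∈ smallShadow r (z n) x := by
  -- Half of the gap, so that even a limit point at distance exactly `ε` from `u 0` stays in the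
  -- open ball.
  set ε := (r - dist (u 0) x) / 2 with hεdef
  have hε : 0 < ε := by rw [hεdef]; linarith
  obtain ⟨T, hT, hnear⟩ := exists_forall_ray_near hu hε
  -- `S > T * (2 * r + 3)` makes the total deviation at time `T` less than `1`: an error `3` from
  -- the cone topology and `2 * r` from moving the source, both scaled by `T / S`. `S ≥ T + r` keeps
  -- every source in the ball at distance at least `T` from `u 0`.
  set S := T * (2 * r + 3) + T + r + 1 with hSdef
  have hTr : 0 ≤ T * (2 * r + 3) := by positivity
  have hS : 0 < S := by rw [hSdef]; linarith
  have hTS : T ≤ S := by rw [hSdef]; linarith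
  filter_upwards [eventually_exists_isGeodesicBeyond hz (isometricOn_neg u _)
    (endsAt_neg.2 rfl) hS.le] with n hn
  obtain ⟨σ, hσ0, hσz, hσS⟩ := hn
  rw [neg_zero] at hσ0
  have hσT : dist (σ T) (u (-T)) ≤ T / S * 3 := by
    have := dist_le_mul_of_common_start hS.le hS.le hσz.isometricOn (isometricOn_neg u _)
      (by simp [hσ0]) (l := T / S) ⟨by positivity, by rwa [div_le_one hS]⟩
    rw [div_mul_cancel₀ _ hS.ne'] at this
    exact this.trans (by gcongr)
  have hsmall : T / S * (2 * r) + T / S * 3 < 1 := by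
    rw [← mul_add, div_mul_eq_mul_div, div_lt_one hS]
    linarith
  have hTS0 : 0 ≤ T / S := by positivity
  cases hzn : z n with
  | pt y =>
    rw [hzn] at hσz
    obtain ⟨L, hL, hσ, rfl⟩ := hσz
    intro y' hy'
    rw [Metric.mem_ball, dist_comm] at hy'
    obtain ⟨c, hc0, hca, hc⟩ := exists_isometricOn (u 0) y'
    obtain ⟨ρ, hρ, hρ0, hρη⟩ := exists_ray y' u.pos
    have hL0 : 0 < L := hS.trans_le hL
    have h1 := hσ 0 ⟨le_rfl, hL0.le⟩ L ⟨hL0.le, le_rfl⟩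
    rw [hσ0, zero_sub, abs_neg, abs_of_pos hL0] at h1
    have hTa : T ≤ dist (u 0) y' := by linarith [dist_triangle_right (u 0) (σ L) y']
    have h2 := dist_le_fellow_travel (D := 0) (E := r) hL0 dist_nonneg hσ hc hT (hTS.trans hL) hTa
      (by simp [hσ0, hc0]) (by rw [hca]; exact hy'.le)
    have h3 : T / L ≤ T / S := by gcongr
    have h4 : dist (c T) (u (-T)) < 1 := by
      have h5 := mul_le_mul_of_nonneg_right h3 (by linarith : 0 ≤ 2 * r)
      linarith [dist_triangle_left (c T) (u (-T)) (σ T)]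
    obtain ⟨t, ht, hto⟩ := hnear _ c ρ hTa hc hc0 h4 hρ (hρ0.trans hca.symm) hρη
    exact rayMeetsBall_iff.2 ⟨ρ, hρ, hρ0, hρη, t, ht, by
      linarith [dist_triangle (ρ t) (u 0) x]⟩
  | bd ξ =>
    rw [hzn] at hσz
    obtain ⟨hσ, hσξ⟩ := hσz
    -- No line from `ξ` to `u⁺` is given in advance; it arises as a limit of rays to `u⁺` that start
    -- ever further along `σ` and all pass within `ε` of `u 0`.
    choose ρ hρ hρ0 hρη using fun k : ℕ => exists_ray (σ (k + T)) u.pos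
    have hσ1 : dist (σ T) (u (-T)) < 1 := by nlinarith
    choose b hb hbo using fun k : ℕ => hnear (k + T) σ (ρ k) (by simp)
      (hσ.mono fun s hs => hs.1) hσ0 hσ1 (hρ k) (hρ0 k) (hρη k)
    obtain ⟨w, hwn, hwp, hw⟩ := exists_line_limit_of_rays (hyperfilter ℕ) (C := 0) (c := fun _ => σ)
      (a := fun k => k + T) (o := u 0) hσξ hρ hρη (fun k => by positivity)
      (fun k => hσ.mono fun s hs => hs.1) (fun _ => hσ0) (fun k => (hρ0 k).symm) hb
      (fun k => (hbo k).le) (by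
        intro t ht
        refine Eventually.filter_mono Nat.hyperfilter_le_atTop ?_
        filter_upwards [tendsto_natCast_atTop_atTop.eventually_ge_atTop t] with k hk
        exact ⟨by linarith, by simp⟩)
    refine ⟨w, hwn, hwp, ?_⟩
    have h0 := hw 0
    simp only [add_zero] at h0
    have h1 := le_of_tendsto' (h0.dist tendsto_const_nhds) fun k => (hbo k).le
    rw [Metric.mem_ball]
    linarith [dist_triangle (w 0) (u 0) x]

theorem subset_liminf_smallShadow {ξ : Boundary X} {x : X} {r : ℝ} (hr : 0 < r)
    {z : ℕ → Compactification X} (hz : Tendsto z atTop (𝓝 (Compactification.bd ξ))) :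
    shadow r ξ x ∩ recBoundary X ⊆
      liminf (fun n => smallShadow r (z n) x ∩ recBoundary X) atTop := by
  rintro _ ⟨⟨u, rfl, rfl, hux⟩, hrec⟩
  rw [mem_liminf_iff_eventually_mem]
  filter_upwards [eventually_mem_smallShadow hrec hr hux hz] with n hn
  exact ⟨hn, hrec⟩

end Shadows

end CAT0

open CAT0
theorem mainTheorem6 {X : Type*} [MetricSpace X] [ProperSpace X] [HadamardSpace X]
    (ξ : Boundary X) (x : X) (r : ℝ) (hr : 0 < r)
    (z : ℕ → Compactification X) (hz : Tendsto z atTop (𝓝 (Compactification.bd ξ))) :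
    (limsup (fun n => largeShadow r (z n) x ∩ recBoundary X) atTop ⊆
        (shadow r ξ x ∪ shadowFrontier r ξ x) ∩ recBoundary X ∧
      limsup (fun n => smallShadow r (z n) x ∩ recBoundary X) atTop ⊆
        (shadow r ξ x ∪ shadowFrontier r ξ x) ∩ recBoundary X) ∧
    (shadow r ξ x ∩ recBoundary X ⊆
        liminf (fun n => largeShadow r (z n) x ∩ recBoundary X) atTop ∧
      shadow r ξ x ∩ recBoundary X ⊆
        liminf (fun n => smallShadow r (z n) x ∩ recBoundary X) atTop) := by
  have hsub : ∀ n, smallShadow r (z n) x ∩ recBoundary X ⊆ largeShadow r (z n) x ∩ recBoundary X :=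
    fun n => inter_subset_inter_left _ (smallShadow_subset_largeShadow hr (z n) x)
  refine ⟨⟨limsup_largeShadow_subset hr hz, fun η hη => limsup_largeShadow_subset hr hz ?_⟩,
    ⟨fun η hη => ?_, subset_liminf_smallShadow hr hz⟩⟩
  · rw [mem_limsup_iff_frequently_mem] at hη ⊢
    exact hη.mono fun n hn => hsub n hn
  · have h := subset_liminf_smallShadow hr hz hη
    rw [mem_liminf_iff_eventually_mem] at h ⊢
    exact h.mono fun n hn => hsub n hn
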